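/- **Model.** Let $G$ and $H$ be finite groups. For $f,g:G\to H$ let $\mathrm{dist}(f,g)=|\{x\in G: f(x)\neq g(x)\}|/|G|$; call $f$ *$\varepsilon$-far from a homomorphism* if $\min_g \mathrm{dist}(f,g)>\varepsilon$, where $g$ ranges over all group homomorphisms $G\to H$. A *tester* is a randomized adaptive algorithm that makes queries $x\in G$ to an oracle and finally accepts or rejects. The oracle holds a table of values, which is initially the input function $f$, and answers a query $x$ with the current value at $x$. An *online budget-managing adversary* with rate $t\in\mathbb{N}$ knows $f$, the tester (but not its future coin tosses) and all queries made so far; after each answered query it may manipulate entries of the table, subject to the condition that, for every $i$, the total number of manipulations made by the time $i$ queries have been answered is at most $t\cdot i$. An *erasure* adversary manipulates an entry by replacing it with a special symbol $\perp\notin H$; a *corruption* adversary manipulates an entry by replacing it with an arbitrary element of $H$. The tester is an *$\varepsilon$-tester for group homomorphism in the presence of* a class of adversaries if, for every $f:G\to H$ and every strategy of an adversary in the class, it accepts with probability at least $2/3$ if $f$ is a homomorphism, and rejects with probability at least $2/3$ if $f$ is $\varepsilon$-far from a homomorphism (probability over the internal randomness of the tester). It has *1-sided error* if in the first case it always accepts.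 **Theorem.** There exist absolute constants $c>0$ and $C>0$ such that for all finite groups $G$ and $H$, all $\varepsilon\in(0,1)$ and all integers $t\ge 0$ with $$t\le c\cdot\min\{\varepsilon^2,\,1/\log_2^2|G|\}\cdot|G|$$ (where $1/\log_2^2|G|$ is read as $+\infty$ if $|G|=1$), there is a tester which makes at most $C\cdot(1/\varepsilon+\log_2 t)$ queries (where $\log_2 t$ is read as $0$ if $t=0$), which is an $\varepsilon$-tester for group homomorphism of functions $f:G\to H$ in the presence of every $t$-online erasure budget-managing adversary and also in the presence of every $t$-online corruption budget-managing adversary, and which has 1-sided error in the presence of erasure adversaries. -/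

import Mathlib

namespace HomTest

universe u v

/-- A deterministic adaptive query algorithm (decision tree) with query points in `X` and oracle
answers in `A`. It either stops with a verdict (`true` is accept, `false` is reject), or queries a
point and continues in a way that depends on the answer. -/
inductive QueryTree (X : Type u) (A : Type v) : Type (max u v)
  | verdict (b : Bool) : QueryTree X A
  | query (x : X) (next : A → QueryTree X A) : QueryTree X A

namespace QueryTree

variable {X : Type u} {A : Type v}

/-- On every sequence of answers, the algorithm makes at most `n` queries. -/
def MakesAtMost : QueryTree X A → ℕ → Prop
  | verdict _, _ => True
  | query _ _, 0 => False
  | query _ next, n + 1 => ∀ a, (next a).MakesAtMost n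

end QueryTree

/-- An online adversarial strategy: `S h` is the whole table of values that the oracle holds after
the queries in the list `h` have been made and answered (most recent query first). So the next
query `x` is answered by `S h x`, after which the adversary replaces the table `S h` by
`S (x :: h)`. -/
abbrev Strategy (X : Type u) (A : Type v) := List X → X → A

namespace Strategy

variable {X : Type u} {A : Type v}

/-- The total number of manipulations (changes of a single table entry) that the strategy has
made by the time the queries in `h` have been answered and the table has become `S h`. -/
noncomputable def manipulations (S : Strategy X A) : List X → ℕ
  | [] => 0
  | x :: h => manipulations S h + {z | S (x :: h) z ≠ S h z}.ncard

/-- Budget management at rate `t`: every answered query adds `t` manipulations to the budget,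
and unused manipulations can be saved and deployed at any later point. -/
def WithinBudget (t : ℕ) (S : Strategy X A) : Prop :=
  ∀ h : List X, S.manipulations h ≤ t * h.length

end Strategy

/-- The verdict of a deterministic query algorithm that runs against a strategy, when the queries
in `h` have already been made. -/
def QueryTree.run {X : Type u} {A : Type v} (S : Strategy X A) : QueryTree X A → List X → Bool
  | .verdict b, _ => b
  | .query x next, h => (next (S h x)).run S (x :: h)

section Groups

variable {G : Type u} {H : Type v}

/-- A `t`-online erasure budget-managing adversary for the input `f`. Answers are in `Option H`,
and `none` is the erasure symbol. -/
structure IsErasureAdversary (t : ℕ) (f : G → H) (S : Strategy G (Option H)) : Prop where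
  init : ∀ z, S [] z = some (f z)
  erases : ∀ h x z, S (x :: h) z ≠ S h z → S (x :: h) z = none
  budget : S.WithinBudget t

/-- A `t`-online corruption budget-managing adversary for the input `f`: a manipulated value is
replaced by an arbitrary element of `H`. -/
structure IsCorruptionAdversary (t : ℕ) (f : G → H) (S : Strategy G (Option H)) : Prop where
  init : ∀ z, S [] z = some (f z)
  corrupts : ∀ h x z, S (x :: h) z ≠ S h z → ∃ y : H, S (x :: h) z = some y
  budget : S.WithinBudget t

/-- A (randomized) tester: a probability distribution over deterministic query algorithms. -/
abbrev Tester (G : Type u) (H : Type v) := PMF (QueryTree G (Option H))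

/-- The distribution of the verdict of the tester against a strategy, over the internal randomness
of the tester. -/
noncomputable def Tester.outcome (T : Tester G H) (S : Strategy G (Option H)) : PMF Bool :=
  T.map fun τ => τ.run S []

/-- Worst-case query complexity: whatever its coins and the answers, the tester makes at most `q`
queries. -/
def Tester.MakesAtMost (T : Tester G H) (q : ℕ) : Prop :=
  ∀ τ ∈ T.support, τ.MakesAtMost q

/-- Relative Hamming distance. -/
noncomputable def relDist (f g : G → H) : ℝ :=
  ({x | f x ≠ g x}.ncard : ℝ) / (Nat.card G : ℝ)

variable [Group G] [Group H]

/-- The function `f` is a group homomorphism. -/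
def IsHom (f : G → H) : Prop := ∀ x y, f (x * y) = f x * f y

/-- The distance from `f` to the (nonempty) set of group homomorphisms. -/
noncomputable def distToHom (f : G → H) : ℝ :=
  ⨅ g : {g : G → H // IsHom g}, relDist f g

/-- `T` is an online `ε`-tester for group homomorphism in the presence of every adversary in the
class `Adv`, where `Adv f S` says that `S` is an admissible strategy on the input `f`. -/
def Tester.IsOnlineTester (T : Tester G H) (ε : ℝ)
    (Adv : (G → H) → Strategy G (Option H) → Prop) : Prop :=
  ∀ f S, Adv f S →
    (IsHom f → 2 / 3 ≤ T.outcome S true) ∧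
    (ε < distToHom f → 2 / 3 ≤ T.outcome S false)

/-- `T` has 1-sided error in the presence of the adversaries in `Adv`: it always accepts every
homomorphism. -/
def Tester.HasOneSidedError (T : Tester G H)
    (Adv : (G → H) → Strategy G (Option H) → Prop) : Prop :=
  ∀ f S, Adv f S → IsHom f → T.outcome S true = 1

end Groups

end HomTest

/-! A classical two-query linearity check fails online: after seeing `x` and `y` the adversary
spoils `x * y`. The random subproduct test instead queries `k` uniform points and then the ordered
product of a random subset of them. The points reveal the candidates for the last query, but not the
subset. Two independent subsets give the same product with probability at most `1 / 2 ^ k + 1 /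
|G|`, so by Cauchy–Schwarz the last query rarely lands in the small manipulated set, even though
that set depends on the points (`prob_subProd_mem_sq_le`). With high probability every answer is
therefore the original one, and erasures and corruptions need no separate analysis.

Soundness on clean answers: if the tests of sizes `k` and `2 k` both rarely fail, splitting `2 k`
points into halves shows that `f (y * z) = f y * f z` for most pairs (`blr_le_subProdFail`), so `f`
is close to a homomorphism `g` (`exists_isHom_near_of_blr`). But `f` is `ε`-far and `k ≥ 9 / ε`, so
the sample probably meets a point where `f` and `g` differ; the random subset then exposes this
about half the time (`le_subProdFail_of_near`), a contradiction. A constant number of rounds, each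
with both sizes, suffices. Accepting exactly when some homomorphism fits the unerased answers gives
1-sided error. -/

namespace HomTest

open scoped BigOperators

/-! ### Uniform probability on finite types. -/

section Prob

variable {α β : Type*} [Fintype α] [Fintype β]

open Classical in
/-- The probability of the event `P` under the uniform distribution. -/
noncomputable def prob (P : α → Prop) : ℝ := 𝔼 a, if P a then 1 else 0

theorem prob_nonneg (P : α → Prop) : 0 ≤ prob P :=
  Finset.expect_nonneg fun a _ => by split_ifs <;> simp

theorem prob_mono {P Q : α → Prop} (h : ∀ a, P a → Q a) : prob P ≤ prob Q :=
  Finset.expect_le_expect fun a _ => by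
    by_cases hP : P a
    · simp [hP, h a hP]
    · simp only [hP, if_false]; split_ifs <;> simp

theorem prob_congr {P Q : α → Prop} (h : ∀ a, P a ↔ Q a) : prob P = prob Q :=
  le_antisymm (prob_mono fun a => (h a).1) (prob_mono fun a => (h a).2)

theorem prob_true [Nonempty α] : prob (fun _ : α => True) = 1 := by
  simp [prob]

theorem prob_le_one (P : α → Prop) : prob P ≤ 1 := by
  rcases isEmpty_or_nonempty α with h | h
  · simp [prob]
  · exact (prob_mono fun _ _ => trivial).trans prob_true.le

theorem prob_or_le (P Q : α → Prop) : prob (fun a => P a ∨ Q a) ≤ prob P + prob Q := by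
  unfold prob
  rw [← Finset.expect_add_distrib]
  refine Finset.expect_le_expect fun a _ => ?_
  by_cases hP : P a <;> by_cases hQ : Q a <;> simp [hP, hQ]

theorem prob_add_prob_not [Nonempty α] (P : α → Prop) : prob P + prob (fun a => ¬ P a) = 1 := by
  unfold prob
  rw [← Finset.expect_add_distrib, ← Fintype.expect_const (ι := α) (1 : ℝ)]
  refine Finset.expect_congr rfl fun a _ => ?_
  by_cases hP : P a <;> simp [hP]

theorem prob_equiv (e : α ≃ β) (P : β → Prop) : prob (fun a => P (e a)) = prob P :=
  Fintype.expect_equiv e _ _ fun _ => rfl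

theorem prob_prod (P : α × β → Prop) : prob P = 𝔼 a, prob fun b => P (a, b) := by
  unfold prob
  rw [← Finset.univ_product_univ, Finset.expect_product]

theorem prob_prod' (P : α × β → Prop) : prob P = 𝔼 b, prob fun a => P (a, b) := by
  rw [← prob_equiv (Equiv.prodComm β α) P, prob_prod]
  rfl

theorem prob_prod_le [Nonempty α] {P : α × β → Prop} {η : ℝ}
    (h : ∀ a, prob (fun b => P (a, b)) ≤ η) : prob P ≤ η := by
  rw [prob_prod]
  exact Finset.expect_le Finset.univ_nonempty fun a _ => h a

theorem prob_prod_le' [Nonempty β] {P : α × β → Prop} {η : ℝ}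
    (h : ∀ b, prob (fun a => P (a, b)) ≤ η) : prob P ≤ η := by
  rw [prob_prod']
  exact Finset.expect_le Finset.univ_nonempty fun a _ => h a

theorem prob_fst [Nonempty β] (P : α → Prop) : prob (fun p : α × β => P p.1) = prob P := by
  rw [prob_prod']
  simp

theorem prob_snd [Nonempty α] (P : β → Prop) : prob (fun p : α × β => P p.2) = prob P := by
  rw [prob_prod]
  simp

theorem prob_and_prod (P : α → Prop) (Q : β → Prop) :
    prob (fun p : α × β => P p.1 ∧ Q p.2) = prob P * prob Q := by
  unfold prob
  rw [Finset.expect_mul_expect, ← Finset.univ_product_univ, Finset.expect_product]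
  refine Finset.expect_congr rfl fun a _ => Finset.expect_congr rfl fun b _ => ?_
  by_cases hP : P a <;> by_cases hQ : Q b <;> simp [hP, hQ]

theorem prob_mem (M : Set α) : prob (fun a => a ∈ M) = M.ncard / Fintype.card α := by
  classical
  unfold prob
  rw [Fintype.expect_eq_sum_div_card, Finset.sum_boole]
  congr 2
  rw [Set.ncard_eq_toFinset_card']
  congr 1
  ext
  simp

theorem prob_eq_const (a : α) : prob (fun x => x = a) = 1 / Fintype.card α := by
  simpa using prob_mem {a}

theorem prob_fin_cons {k : ℕ} (P : (Fin (k + 1) → α) → Prop) :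
    prob P = prob fun p : α × (Fin k → α) => P (Fin.cons p.1 p.2) :=
  (prob_equiv (Fin.consEquiv fun _ => α) P).symm

theorem prob_forall_fin (P : α → Prop) (r : ℕ) :
    prob (fun ω : Fin r → α => ∀ j, P (ω j)) = prob P ^ r := by
  induction r with
  | zero => simp [prob]
  | succ r ih =>
    rw [prob_fin_cons, pow_succ', ← ih, ← prob_and_prod]
    exact prob_congr fun p => by simp [Fin.forall_fin_succ]

end Prob

/-! ### Approximate homomorphisms are close to homomorphisms. -/

section BLR

variable {G H : Type*} [Group G] [Group H]

/-- The map `(y, z) ↦ (a * y, y⁻¹ * z)`. -/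
def shear (a : G) : G × G ≃ G × G where
  toFun p := (a * p.1, p.1⁻¹ * p.2)
  invFun p := (a⁻¹ * p.1, a⁻¹ * p.1 * p.2)
  left_inv p := by simp
  right_inv p := by simp [mul_assoc]

variable [Fintype G]

theorem prob_shear (f : G → H) (a : G) :
    prob (fun p : G × G => f (a * p.2) ≠ f (a * p.1) * f (p.1⁻¹ * p.2)) =
      prob (fun p : G × G => f (p.1 * p.2) ≠ f p.1 * f p.2) := by
  refine (prob_congr fun p => ?_).trans
    (prob_equiv (shear a) fun p => f (p.1 * p.2) ≠ f p.1 * f p.2)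
  simp [shear, mul_assoc]

/-- For random `y, z`, the identities for `(x * y, y⁻¹ * z)` and `(y, y⁻¹ * z)` together express `f
(x * z)` as `f (x * y) * (f y)⁻¹ * f z`. Each pair is uniform, and averaging fixes a good `y`; no
plurality vote is needed. -/
theorem exists_shift_of_blr (f : G → H) (x : G) :
    ∃ v : H, prob (fun y => f (x * y) ≠ v * f y) ≤
      2 * prob (fun p : G × G => f (p.1 * p.2) ≠ f p.1 * f p.2) := by
  have key : prob (fun p : G × G => f (x * p.2) ≠ f (x * p.1) * (f p.1)⁻¹ * f p.2) ≤
      2 * prob (fun p : G × G => f (p.1 * p.2) ≠ f p.1 * f p.2) := by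
    have hsum := prob_or_le (fun p : G × G => f (x * p.2) ≠ f (x * p.1) * f (p.1⁻¹ * p.2))
      (fun p : G × G => f (1 * p.2) ≠ f (1 * p.1) * f (p.1⁻¹ * p.2))
    rw [prob_shear, prob_shear, ← two_mul] at hsum
    refine (prob_mono fun p hp => ?_).trans hsum
    by_contra! hcon
    obtain ⟨h1, h2⟩ := hcon
    rw [one_mul, one_mul] at h2
    exact hp (by rw [h1, h2, mul_assoc, inv_mul_cancel_left])
  rw [prob_prod] at key
  obtain ⟨y, -, hy⟩ := Finset.exists_le_of_expect_le Finset.univ_nonempty key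
  exact ⟨f (x * y) * (f y)⁻¹, hy⟩

/-- A function that satisfies the homomorphism identity on most pairs is close to a homomorphism. -/
theorem exists_isHom_near_of_blr (f : G → H)
    (hδ : prob (fun p : G × G => f (p.1 * p.2) ≠ f p.1 * f p.2) < 1 / 6) :
    ∃ g : G → H, IsHom g ∧ prob (fun x => f x ≠ g x) ≤
      3 * prob (fun p : G × G => f (p.1 * p.2) ≠ f p.1 * f p.2) := by
  choose g hg using exists_shift_of_blr f
  set δ := prob (fun p : G × G => f (p.1 * p.2) ≠ f p.1 * f p.2) with hδdef
  refine ⟨g, fun x x' => ?_, ?_⟩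
  -- The three failures have total probability at most `6 * δ < 1`, so a single `y` avoids them all
  -- and can be cancelled.
  · have h1 : prob (fun y => f (x * x' * y) ≠ g (x * x') * f y ∨
        (f (x' * y) ≠ g x' * f y ∨ f (x * (x' * y)) ≠ g x * f (x' * y))) ≤ 2 * δ + (2 * δ + 2 * δ) := by
      refine (prob_or_le _ _).trans (add_le_add (hg _) ((prob_or_le _ _).trans
        (add_le_add (hg _) ?_)))
      exact (prob_equiv (Equiv.mulLeft x') fun y => f (x * y) ≠ g x * f y).trans_le (hg x)
    have h2 := prob_add_prob_not (fun y => f (x * x' * y) ≠ g (x * x') * f y ∨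
        (f (x' * y) ≠ g x' * f y ∨ f (x * (x' * y)) ≠ g x * f (x' * y)))
    by_contra hne
    rw [prob_congr (Q := fun _ : G => True), prob_true] at h1
    · linarith
    · intro y
      simp only [iff_true]
      by_contra! hcon
      obtain ⟨h1, h2, h3⟩ := hcon
      rw [mul_assoc, h3, h2, ← mul_assoc] at h1
      exact hne (mul_right_cancel h1).symm
  · rw [← prob_fst (β := G) fun x => f x ≠ g x]
    have h1 : prob (fun p : G × G => f (p.1 * p.2) ≠ g p.1 * f p.2) ≤ 2 * δ :=
      prob_prod_le fun x => hg x
    have : 3 * δ = δ + 2 * δ := by ring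
    rw [this]
    refine (prob_mono fun p hp => ?_).trans
      ((prob_or_le (fun p : G × G => f (p.1 * p.2) ≠ f p.1 * f p.2) _).trans
        (add_le_add le_rfl h1))
    by_contra! hcon
    exact hp (mul_right_cancel (hcon.1.symm.trans hcon.2))

end BLR

/-! ### Distribution of random subproducts. -/

section SubProd

/-- The ordered product of the `x i` with `b i = true`. -/
def subProd {M : Type*} [Monoid M] {k : ℕ} (x : Fin k → M) (b : Fin k → Bool) : M :=
  (List.ofFn fun i => if b i then x i else 1).prod

theorem subProd_cons {M : Type*} [Monoid M] {k : ℕ} (a : M) (x : Fin k → M) (c : Bool)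
    (b : Fin k → Bool) :
    subProd (Fin.cons a x) (Fin.cons c b) = (if c then a else 1) * subProd x b := by
  simp [subProd, List.ofFn_succ]

theorem subProd_append {M : Type*} [Monoid M] {m n : ℕ} (x : Fin m → M) (y : Fin n → M)
    (b : Fin m → Bool) (c : Fin n → Bool) :
    subProd (Fin.append x y) (Fin.append b c) = subProd x b * subProd y c := by
  rw [subProd, subProd, subProd, ← List.prod_append, ← List.ofFn_fin_append]
  congr 2
  ext i
  induction i using Fin.addCases <;> simp

theorem IsHom.map_subProd {G H : Type*} [Group G] [Group H] {g : G → H} (hg : IsHom g) {k : ℕ}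
    (x : Fin k → G) (b : Fin k → Bool) : g (subProd x b) = subProd (fun i => g (x i)) b := by
  have h1 : g 1 = 1 := by simpa using hg 1 1
  induction k with
  | zero => simpa [subProd] using h1
  | succ k ih =>
    induction x using Fin.consCases with
    | _ a x =>
    induction b using Fin.consCases with
    | _ c b =>
    have : (fun i => g (Fin.cons (α := fun _ => G) a x i)) = Fin.cons (g a) (fun i => g (x i)) := by
      ext i
      induction i using Fin.cases <;> simp
    rw [this, subProd_cons, subProd_cons, hg, ih]
    cases c <;> simp [h1]

variable {G : Type*} [Group G] [Fintype G]

/-- The first selected factor is uniform and independent of the rest, so the product is uniform. -/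
theorem prob_subProd {k : ℕ} (b : Fin k → Bool) (hb : ∃ i, b i = true) (P : G → Prop) :
    prob (fun x : Fin k → G => P (subProd x b)) = prob P := by
  induction k with
  | zero => exact hb.choose.elim0
  | succ k ih =>
    induction b using Fin.consCases with
    | _ c b =>
    rw [prob_fin_cons]
    simp only [subProd_cons]
    cases c with
    | true =>
      rw [prob_prod']
      simp only [if_true]
      refine (Finset.expect_congr rfl fun x _ =>
        prob_equiv (Equiv.mulRight (subProd x b)) P).trans ?_
      simp
    | false =>
      have hb' : ∃ i, b i = true := by simpa [Fin.exists_fin_succ] using hb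
      simp only [Bool.false_eq_true, if_false, one_mul]
      rw [prob_snd (α := G) fun x : Fin k → G => P (subProd x b), ih b hb']

/-- At the first position where `b` and `c` differ, that point occurs on one side only, so the later
points determine it. -/
theorem prob_subProd_eq_le {k : ℕ} (b c : Fin k → Bool) (hbc : b ≠ c) :
    prob (fun x : Fin k → G => subProd x b = subProd x c) ≤ 1 / Fintype.card G := by
  induction k with
  | zero => exact absurd (Subsingleton.elim b c) hbc
  | succ k ih =>
    induction b using Fin.consCases with
    | _ b₀ b =>
    induction c using Fin.consCases with
    | _ c₀ c =>
    rw [prob_fin_cons]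
    simp only [subProd_cons]
    by_cases h0 : b₀ = c₀
    · subst h0
      simp only [mul_right_inj]
      rw [prob_snd (α := G) fun x : Fin k → G => subProd x b = subProd x c]
      exact ih b c fun h => hbc (by rw [h])
    · refine prob_prod_le' fun x => ?_
      cases b₀ <;> cases c₀
      · exact absurd rfl h0
      · refine (prob_mono fun a ha => ?_).trans_eq (prob_eq_const (subProd x b * (subProd x c)⁻¹))
        simpa [eq_mul_inv_iff_mul_eq] using Eq.symm ha
      · refine (prob_mono fun a ha => ?_).trans_eq (prob_eq_const (subProd x c * (subProd x b)⁻¹))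
        simpa [eq_mul_inv_iff_mul_eq] using ha
      · exact absurd rfl h0

theorem card_fin_bool (k : ℕ) : (Fintype.card (Fin k → Bool) : ℝ) = 2 ^ k := by simp

/-- Only the empty subset, of probability `1 / 2 ^ k`, gives a non-uniform product. -/
theorem prob_subProd_le (k : ℕ) (P : G → Prop) :
    prob (fun p : (Fin k → G) × (Fin k → Bool) => P (subProd p.1 p.2)) ≤ prob P + 1 / 2 ^ k := by
  classical
  have h1 := prob_eq_const (fun _ : Fin k => false)
  rw [card_fin_bool] at h1
  rw [prob_prod', ← h1]
  have : prob P = 𝔼 _b : Fin k → Bool, prob P := by simp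
  rw [this]
  unfold prob
  rw [← Finset.expect_add_distrib]
  refine Finset.expect_le_expect fun b _ => ?_
  by_cases hb : ∃ i, b i = true
  · have h2 := (prob_subProd b hb P).le
    unfold prob at h2
    refine h2.trans (le_add_of_nonneg_right ?_)
    split_ifs <;> simp
  · have hb' : b = fun _ => false := by
      push Not at hb
      ext i
      simpa using hb i
    rw [if_pos hb']
    exact (prob_le_one _).trans (le_add_of_nonneg_left (prob_nonneg P))

theorem le_prob_subProd (k : ℕ) (P : G → Prop) :
    prob P ≤ prob (fun p : (Fin k → G) × (Fin k → Bool) => P (subProd p.1 p.2)) + 1 / 2 ^ k := by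
  have h1 := prob_subProd_le k fun x => ¬ P x
  have h2 := prob_add_prob_not P
  have h3 := prob_add_prob_not fun p : (Fin k → G) × (Fin k → Bool) => P (subProd p.1 p.2)
  linarith

/-- The probability that two independent random subproducts of the same random tuple agree. -/
theorem prob_collision_le (k : ℕ) :
    (𝔼 b : Fin k → Bool, 𝔼 c : Fin k → Bool,
      prob (fun x : Fin k → G => subProd x b = subProd x c)) ≤ 1 / 2 ^ k + 1 / Fintype.card G := by
  classical
  refine Finset.expect_le Finset.univ_nonempty fun b _ => ?_
  have h1 := prob_eq_const b
  rw [card_fin_bool] at h1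
  rw [← h1, ← Fintype.expect_const (ι := Fin k → Bool) (1 / (Fintype.card G : ℝ))]
  conv_rhs => rw [prob]
  rw [← Finset.expect_add_distrib]
  refine Finset.expect_le_expect fun c _ => ?_
  by_cases h : c = b
  · simpa [h] using (prob_le_one _).trans (le_add_of_nonneg_right (by positivity))
  · simpa [h] using prob_subProd_eq_le b c (Ne.symm h)

/-- This is the core estimate against the adversary: `M` may depend on the points `x`, but not on
the subset. Cauchy–Schwarz on `M x` bounds the hitting probability by the collision probability of
the subproduct given `x`; a second Cauchy–Schwarz averages over `x`. -/
theorem prob_subProd_mem_sq_le (k : ℕ) (M : (Fin k → G) → Set G) {m : ℝ}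
    (hM : ∀ x, ((M x).ncard : ℝ) ≤ m) :
    prob (fun p : (Fin k → G) × (Fin k → Bool) => subProd p.1 p.2 ∈ M p.1) ^ 2 ≤
      m * (1 / 2 ^ k + 1 / Fintype.card G) := by
  classical
  have hm : 0 ≤ m := (Nat.cast_nonneg _).trans (hM 1)
  let ρ (x : Fin k → G) (g : G) : ℝ := prob fun b => subProd x b = g
  have h1 (x : Fin k → G) : prob (fun b => subProd x b ∈ M x) ≤ ∑ g ∈ (M x).toFinset, ρ x g := by
    simp only [ρ, prob]
    rw [← Finset.expect_sum_comm]
    refine Finset.expect_le_expect fun b _ => ?_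
    simp
  have h2 (x : Fin k → G) : prob (fun b => subProd x b ∈ M x) ^ 2 ≤ m * ∑ g, ρ x g ^ 2 := by
    calc _ ≤ (∑ g ∈ (M x).toFinset, ρ x g) ^ 2 := pow_le_pow_left₀ (prob_nonneg _) (h1 x) 2
      _ ≤ (M x).toFinset.card * ∑ g ∈ (M x).toFinset, ρ x g ^ 2 := sq_sum_le_card_mul_sum_sq
      _ ≤ m * ∑ g, ρ x g ^ 2 := by
        refine mul_le_mul ?_ (Finset.sum_le_univ_sum_of_nonneg fun g => sq_nonneg _)
          (Finset.sum_nonneg fun g _ => sq_nonneg _) hm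
        rw [← Set.ncard_eq_toFinset_card']
        exact hM x
  have h3 (x : Fin k → G) : ∑ g, ρ x g ^ 2 =
      𝔼 b : Fin k → Bool, 𝔼 c : Fin k → Bool, if subProd x b = subProd x c then (1 : ℝ) else 0 := by
    simp only [ρ, prob, sq, Fintype.expect_mul_expect]
    rw [← Finset.expect_sum_comm]
    refine Finset.expect_congr rfl fun b _ => ?_
    rw [← Finset.expect_sum_comm]
    refine Finset.expect_congr rfl fun c _ => ?_
    simp [eq_comm]
  have h4 : (𝔼 x : Fin k → G, ∑ g, ρ x g ^ 2) ≤ 1 / 2 ^ k + 1 / Fintype.card G := by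
    refine le_of_eq_of_le ?_ (prob_collision_le (G := G) k)
    simp only [h3, prob]
    rw [Finset.expect_comm]
    refine Finset.expect_congr rfl fun b _ => ?_
    rw [Finset.expect_comm]
  rw [prob_prod]
  calc _ ≤ 𝔼 x, prob (fun b => subProd x b ∈ M x) ^ 2 := by
        have := Finset.expect_mul_sq_le_sq_mul_sq Finset.univ
          (fun x : Fin k → G => prob (fun b => subProd x b ∈ M x)) (fun _ => 1)
        simpa using this
    _ ≤ 𝔼 x, m * ∑ g, ρ x g ^ 2 := Finset.expect_le_expect fun x _ => h2 x
    _ = m * 𝔼 x, ∑ g, ρ x g ^ 2 := (Finset.mul_expect _ _ _).symm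
    _ ≤ _ := mul_le_mul_of_nonneg_left h4 hm

end SubProd

theorem prob_ne_eq_relDist {G H : Type*} [Fintype G] (f g : G → H) :
    prob (fun x => f x ≠ g x) = relDist f g := by
  rw [relDist, Nat.card_eq_fintype_card]
  exact prob_mem {x | f x ≠ g x}

/-! ### Soundness of the subproduct test without an adversary. -/

section Soundness

variable {G H : Type*} [Group G] [Group H] [Fintype G]

/-- The probability that a random subproduct of `k` random points violates the homomorphism
identity for `f`. -/
noncomputable def subProdFail (f : G → H) (k : ℕ) : ℝ :=
  prob fun p : (Fin k → G) × (Fin k → Bool) =>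
    f (subProd p.1 p.2) ≠ subProd (fun i => f (p.1 i)) p.2

/-- Replacing each member of a uniform pair by a subproduct costs `1 / 2 ^ k`. The size `k` test
handles each factor, and the size `2 k` test handles their product, which is a subproduct of the
concatenated tuple. -/
theorem blr_le_subProdFail (f : G → H) (k : ℕ) :
    prob (fun p : G × G => f (p.1 * p.2) ≠ f p.1 * f p.2) ≤
      2 * subProdFail f k + subProdFail f (k + k) + 2 / 2 ^ k := by
  let B := (Fin k → G) × (Fin k → Bool)
  let s (p : B) : G := subProd p.1 p.2
  let F (p : B) : H := subProd (fun i => f (p.1 i)) p.2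
  have h1 : prob (fun p : G × G => f (p.1 * p.2) ≠ f p.1 * f p.2) ≤
      prob (fun p : B × G => f (s p.1 * p.2) ≠ f (s p.1) * f p.2) + 1 / 2 ^ k := by
    rw [prob_prod', prob_prod' (α := B), ← Fintype.expect_const (ι := G) (1 / 2 ^ k : ℝ),
      ← Finset.expect_add_distrib]
    exact Finset.expect_le_expect fun z _ =>
      le_prob_subProd k fun y => f (y * z) ≠ f y * f z
  have h2 : prob (fun p : B × G => f (s p.1 * p.2) ≠ f (s p.1) * f p.2) ≤
      prob (fun p : B × B => f (s p.1 * s p.2) ≠ f (s p.1) * f (s p.2)) + 1 / 2 ^ k := by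
    rw [prob_prod, prob_prod (α := B), ← Fintype.expect_const (ι := B) (1 / 2 ^ k : ℝ),
      ← Finset.expect_add_distrib]
    exact Finset.expect_le_expect fun z _ =>
      le_prob_subProd k fun y => f (s z * y) ≠ f (s z) * f y
  have h3 : subProdFail f (k + k) =
      prob fun p : B × B => f (s p.1 * s p.2) ≠ F p.1 * F p.2 := by
    let e : B × B ≃ (Fin (k + k) → G) × (Fin (k + k) → Bool) :=
      (Equiv.prodProdProdComm _ _ _ _).trans
        ((Fin.appendEquiv k k).prodCongr (Fin.appendEquiv k k))
    refine (prob_equiv e _).symm.trans (prob_congr fun p => ?_)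
    have : (fun i => f (Fin.append p.1.1 p.2.1 i)) =
        Fin.append (fun i => f (p.1.1 i)) (fun i => f (p.2.1 i)) := by
      ext i
      induction i using Fin.addCases with
      | left i => rw [Fin.append_left, Fin.append_left]
      | right i => rw [Fin.append_right, Fin.append_right]
    change f (subProd (Fin.append p.1.1 p.2.1) (Fin.append p.1.2 p.2.2)) ≠
      subProd (fun i => f (Fin.append p.1.1 p.2.1 i)) (Fin.append p.1.2 p.2.2) ↔ _
    rw [this, subProd_append, subProd_append]
  have h4 : prob (fun p : B × B => f (s p.1 * s p.2) ≠ f (s p.1) * f (s p.2)) ≤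
      prob (fun p : B × B => f (s p.1 * s p.2) ≠ F p.1 * F p.2) +
      (prob (fun p : B × B => f (s p.1) ≠ F p.1) + prob (fun p : B × B => f (s p.2) ≠ F p.2)) := by
    refine (prob_mono fun p hp => ?_).trans ((prob_or_le _ _).trans
      (add_le_add le_rfl (prob_or_le _ _)))
    by_contra! hcon
    exact hp (by rw [hcon.1, hcon.2.1, hcon.2.2])
  rw [prob_fst (β := B) fun p => f (s p) ≠ F p, prob_snd (α := B) fun p => f (s p) ≠ F p, ← h3] at h4
  have h5 : (2 : ℝ) / 2 ^ k = 1 / 2 ^ k + 1 / 2 ^ k := by ring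
  change _ ≤ subProdFail f (k + k) + (subProdFail f k + subProdFail f k) at h4
  linarith

theorem prob_bool_le {P : Bool → Prop} (h : ¬ (P true ∧ P false)) : prob P ≤ 1 / 2 := by
  unfold prob
  rw [Fintype.expect_eq_sum_div_card, Fintype.sum_bool, Fintype.card_bool]
  by_cases h1 : P true <;> by_cases h2 : P false <;> simp_all

/-- At the first coordinate where `u` and `v` differ, once the later bits are fixed, the two values
of that bit cannot both give equality. -/
theorem prob_subProd_eq_subProd_le {k : ℕ} {u v : Fin k → H} (h : u ≠ v) :
    prob (fun b => subProd u b = subProd v b) ≤ 1 / 2 := by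
  induction k with
  | zero => exact absurd (Subsingleton.elim u v) h
  | succ k ih =>
    induction u using Fin.consCases with
    | _ u₀ u =>
    induction v using Fin.consCases with
    | _ v₀ v =>
    rw [prob_fin_cons]
    simp only [subProd_cons]
    by_cases h0 : u₀ = v₀
    · subst h0
      simp only [mul_right_inj]
      rw [prob_snd (α := Bool) fun b : Fin k → Bool => subProd u b = subProd v b]
      exact ih fun h' => h (by rw [h'])
    · refine prob_prod_le' fun b => prob_bool_le ?_
      rintro ⟨h1, h2⟩
      simp only [Bool.false_eq_true, if_false, if_true, one_mul] at h1 h2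
      rw [h2] at h1
      exact h0 (mul_right_cancel h1)

/-- A passed test requires that `f` and `g` differ at the subproduct, or that the subproducts of
their values agree. The latter has probability at most 1/2 once some sample point separates `f` from
`g`. -/
theorem le_subProdFail_of_near {f g : G → H} (hg : IsHom g) (k : ℕ) :
    1 / 2 - prob (fun x => f x = g x) ^ k - prob (fun x => f x ≠ g x) - 1 / 2 ^ k ≤
      subProdFail f k := by
  let B := (Fin k → G) × (Fin k → Bool)
  have h1 : prob (fun p : B => subProd (fun i => f (p.1 i)) p.2 = subProd (fun i => g (p.1 i)) p.2) ≤
      prob (fun x => f x = g x) ^ k + 1 / 2 := by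
    rw [← prob_forall_fin, prob_prod, ← Fintype.expect_const (ι := Fin k → G) (1 / 2 : ℝ)]
    conv_rhs => rw [prob]
    rw [← Finset.expect_add_distrib]
    refine Finset.expect_le_expect fun x _ => ?_
    by_cases hx : ∀ i, f (x i) = g (x i)
    · rw [if_pos hx]
      exact (prob_le_one _).trans (by norm_num)
    · rw [if_neg hx, zero_add]
      exact prob_subProd_eq_subProd_le fun h => hx fun i => congrFun h i
  have h2 := prob_subProd_le k fun x => f x ≠ g x
  have h3 := prob_add_prob_not fun p : B => f (subProd p.1 p.2) ≠ subProd (fun i => f (p.1 i)) p.2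
  have h4 : prob (fun p : B => ¬ f (subProd p.1 p.2) ≠ subProd (fun i => f (p.1 i)) p.2) ≤
      prob (fun p : B => f (subProd p.1 p.2) ≠ g (subProd p.1 p.2)) +
      prob (fun p : B =>
        subProd (fun i => f (p.1 i)) p.2 = subProd (fun i => g (p.1 i)) p.2) := by
    refine (prob_mono fun p hp => ?_).trans (prob_or_le _ _)
    by_contra! hcon
    rw [not_not] at hp
    exact hcon.2 (by rw [← hp, hcon.1, hg.map_subProd])
  have h5 : subProdFail f k =
      prob fun p : B => f (subProd p.1 p.2) ≠ subProd (fun i => f (p.1 i)) p.2 := rfl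
  change prob (fun p : B => f (subProd p.1 p.2) ≠ g (subProd p.1 p.2)) ≤ _ at h2
  linarith

theorem distToHom_le_prob (f : G → H) {g : G → H} (hg : IsHom g) :
    distToHom f ≤ prob (fun x => f x ≠ g x) := by
  rw [prob_ne_eq_relDist]
  refine ciInf_le (f := fun g : {g : G → H // IsHom g} => relDist f g) ⟨0, ?_⟩ ⟨g, hg⟩
  rintro _ ⟨g, rfl⟩
  simp only [relDist]
  positivity

/-- A function far from homomorphisms fails the random subproduct test of size `k` or the one of
size `2 k` with constant probability. -/
theorem subProdFail_of_far {f : G → H} {ε : ℝ} (hε : 0 < ε) (hf : ε < distToHom f) {k : ℕ}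
    (hk : 8 ≤ k) (hkε : 9 ≤ k * ε) :
    1 / 120 ≤ subProdFail f k ∨ 1 / 120 ≤ subProdFail f (k + k) := by
  by_contra! hcon
  obtain ⟨h1, h2⟩ := hcon
  have hpow : (1 : ℝ) / 2 ^ k ≤ 1 / 256 := by
    apply one_div_le_one_div_of_le (by norm_num)
    calc (256 : ℝ) = 2 ^ 8 := by norm_num
      _ ≤ 2 ^ k := pow_le_pow_right₀ (by norm_num) hk
  have h3 := blr_le_subProdFail f k
  have h5 : (2 : ℝ) / 2 ^ k = 2 * (1 / 2 ^ k) := by ring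
  obtain ⟨g, hg, hfg⟩ := exists_isHom_near_of_blr f (by linarith)
  have h6 := distToHom_le_prob f hg
  have h7 := le_subProdFail_of_near (f := f) hg k
  have h8 := prob_add_prob_not fun x => f x = g x
  -- Agreement is at most `1 - ε ≤ 1 / (1 + ε)`, and Bernoulli gives `(1 + ε) ^ k ≥ 1 + k * ε ≥ 10`.
  have h9 : prob (fun x => f x = g x) ^ k ≤ 1 / 10 := by
    have h10 : prob (fun x => f x = g x) * (1 + ε) ≤ 1 := by
      change _ + prob (fun x => f x ≠ g x) = 1 at h8
      nlinarith
    have h11 : prob (fun x => f x = g x) ^ k * (1 + ε) ^ k ≤ 1 := by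
      rw [← mul_pow]
      exact pow_le_one₀ (mul_nonneg (prob_nonneg _) (by linarith)) h10
    have h12 := one_add_mul_le_pow (show -2 ≤ ε by linarith) k
    have h13 := pow_nonneg (prob_nonneg fun x => f x = g x) k
    nlinarith
  linarith

end Soundness

/-! ### Testers with a query list fixed in advance. -/

section NonAdaptive

variable {X A : Type*}

/-- The algorithm that queries the points in a list in order and then decides by the answers. -/
def QueryTree.ofList : List X → (List A → Bool) → QueryTree X A
  | [], V => .verdict (V [])
  | x :: L, V => .query x fun a => ofList L fun as => V (a :: as)

/-- The answers of the oracle to the queries in a list, after those in `h`. -/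
def Strategy.answers (S : Strategy X A) : List X → List X → List A
  | _, [] => []
  | h, x :: L => S h x :: S.answers (x :: h) L

theorem QueryTree.ofList_makesAtMost (L : List X) (V : List A → Bool) :
    (ofList L V).MakesAtMost L.length := by
  induction L generalizing V with
  | nil => trivial
  | cons x L ih => exact fun a => ih _

theorem QueryTree.run_ofList (S : Strategy X A) (L : List X) (V : List A → Bool) (h : List X) :
    (ofList L V).run S h = V (S.answers h L) := by
  induction L generalizing V h with
  | nil => rfl
  | cons x L ih => exact ih _ _

end NonAdaptive

/-! ### Probability of meeting a manipulated entry. -/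

section Clean

variable {G H : Type*}

/-- All queries in a list, made after those in `h`, are answered by the original value. -/
def Strategy.Clean (S : Strategy G (Option H)) (f : G → H) : List G → List G → Prop
  | _, [] => True
  | h, x :: L => S h x = some (f x) ∧ S.Clean f (x :: h) L

theorem Strategy.clean_append (S : Strategy G (Option H)) (f : G → H) (L L' h : List G) :
    S.Clean f h (L ++ L') ↔ S.Clean f h L ∧ S.Clean f (L.reverse ++ h) L' := by
  induction L generalizing h with
  | nil => simp [Clean]
  | cons x L ih => simp [Clean, ih, and_assoc]

theorem Strategy.Clean.answers_eq {S : Strategy G (Option H)} {f : G → H} {h L : List G}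
    (hc : S.Clean f h L) : S.answers h L = L.map fun x => some (f x) := by
  induction L generalizing h with
  | nil => rfl
  | cons x L ih =>
    obtain ⟨h1, h2⟩ := hc
    simp [answers, h1, ih h2]

/-- A strategy on the input `f` with manipulation budget `t` per query. -/
structure IsBudgeted (t : ℕ) (f : G → H) (S : Strategy G (Option H)) : Prop where
  init : ∀ z, S [] z = some (f z)
  budget : S.WithinBudget t

theorem IsErasureAdversary.isBudgeted {t : ℕ} {f : G → H} {S : Strategy G (Option H)}
    (hS : IsErasureAdversary t f S) : IsBudgeted t f S := ⟨hS.init, hS.budget⟩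

theorem IsCorruptionAdversary.isBudgeted {t : ℕ} {f : G → H} {S : Strategy G (Option H)}
    (hS : IsCorruptionAdversary t f S) : IsBudgeted t f S := ⟨hS.init, hS.budget⟩

theorem IsErasureAdversary.eq_none_or {t : ℕ} {f : G → H} {S : Strategy G (Option H)}
    (hS : IsErasureAdversary t f S) (h : List G) (z : G) : S h z = none ∨ S h z = some (f z) := by
  induction h with
  | nil => exact .inr (hS.init z)
  | cons x h ih =>
    by_cases hne : S (x :: h) z = S h z
    · rwa [hne]
    · exact .inl (hS.erases h x z hne)

theorem IsBudgeted.ncard_le [Finite G] {t : ℕ} {f : G → H} {S : Strategy G (Option H)}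
    (hS : IsBudgeted t f S) (h : List G) : {z | S h z ≠ some (f z)}.ncard ≤ t * h.length := by
  refine le_trans ?_ (hS.budget h)
  induction h with
  | nil => simp [hS.init]
  | cons x h ih =>
    rw [Strategy.manipulations]
    refine le_trans (Set.ncard_le_ncard ?_ (Set.toFinite _)) ((Set.ncard_union_le _ _).trans
      (add_le_add_left ih _))
    intro z hz
    by_contra! hcon
    simp only [Set.mem_union, Set.mem_ofPred_eq, not_or, not_not] at hcon hz
    exact hz (hcon.2.trans hcon.1)

/-- A union bound over independent blocks: the bound `η` holds for every fixed history, so earlier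
blocks can be conditioned on. `N` caps the history length, hence the adversary's budget. -/
theorem prob_not_clean_flatten_le {B : Type*} [Fintype B] [Nonempty B]
    (S : Strategy G (Option H)) (f : G → H) (q : B → List G) {l N : ℕ} {η : ℝ}
    (hl : ∀ b, (q b).length = l)
    (hq : ∀ h : List G, h.length + l ≤ N → prob (fun b => ¬ S.Clean f h (q b)) ≤ η)
    (r : ℕ) (h : List G) (hN : h.length + r * l ≤ N) :
    prob (fun ω : Fin r → B => ¬ S.Clean f h (List.ofFn fun j => q (ω j)).flatten) ≤ r * η := by
  induction r generalizing h with
  | zero => simp [prob, Strategy.Clean]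
  | succ r ih =>
    have hr : (r + 1) * l = r * l + l := by ring
    have h1 : prob (fun p : B × (Fin r → B) => ¬ S.Clean f ((q p.1).reverse ++ h)
        (List.ofFn fun j => q (p.2 j)).flatten) ≤ r * η := by
      refine prob_prod_le fun b => ih ((q b).reverse ++ h) ?_
      simp only [List.length_append, List.length_reverse, hl]
      omega
    have h2 := hq h (by omega)
    rw [← prob_fst (β := Fin r → B) fun b => ¬ S.Clean f h (q b)] at h2
    have hs : ((r + 1 : ℕ) : ℝ) * η = η + r * η := by push_cast; ring
    rw [prob_fin_cons, hs]
    refine (prob_mono fun p hp => ?_).trans ((prob_or_le _ _).trans (add_le_add h2 h1))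
    simpa only [List.ofFn_succ, Fin.cons_zero, Fin.cons_succ, List.flatten_cons,
      Strategy.clean_append, not_and_or] using hp

variable [Group G] [Fintype G] {t N : ℕ} {f : G → H} {S : Strategy G (Option H)}

theorem IsBudgeted.prob_point_le (hS : IsBudgeted t f S) {h : List G} (hN : h.length ≤ N) :
    prob (fun x => S h x ≠ some (f x)) ≤ t * N / Fintype.card G := by
  refine (prob_mem {x | S h x ≠ some (f x)}).trans_le ?_
  gcongr
  exact_mod_cast (hS.ncard_le h).trans (Nat.mul_le_mul_left t hN)

/-- The set of manipulated entries is fixed by the history and the `k` points, before the subset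
matters. The bound `y` stands in for a square root. -/
theorem IsBudgeted.prob_subProd_le (hS : IsBudgeted t f S) {k : ℕ} {h : List G}
    (hN : h.length + k ≤ N) {y : ℝ} (hy : 0 ≤ y)
    (hty : t * N * (1 / 2 ^ k + 1 / Fintype.card G) ≤ y ^ 2) :
    prob (fun p : (Fin k → G) × (Fin k → Bool) =>
      S ((List.ofFn p.1).reverse ++ h) (subProd p.1 p.2) ≠ some (f (subProd p.1 p.2))) ≤ y := by
  refine abs_le_of_sq_le_sq' ?_ hy |>.2
  refine le_trans (prob_subProd_mem_sq_le k (m := t * N)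
    (fun x => {z | S ((List.ofFn x).reverse ++ h) z ≠ some (f z)}) fun x => ?_) hty
  refine le_trans (Nat.cast_le.2 (hS.ncard_le _)) ?_
  simp only [List.length_append, List.length_reverse, List.length_ofFn]
  exact_mod_cast Nat.mul_le_mul_left t (by omega)

/-- The queries of the random subproduct test. -/
def subProdQueries {k : ℕ} (p : (Fin k → G) × (Fin k → Bool)) : List G :=
  List.ofFn p.1 ++ [subProd p.1 p.2]

theorem IsBudgeted.prob_not_clean_subProdQueries_le (hS : IsBudgeted t f S) {k : ℕ} {h : List G}
    (hN : h.length + (k + 1) ≤ N) {y : ℝ} (hy : 0 ≤ y)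
    (hty : t * N * (1 / 2 ^ k + 1 / Fintype.card G) ≤ y ^ 2) :
    prob (fun p : (Fin k → G) × (Fin k → Bool) => ¬ S.Clean f h (subProdQueries p)) ≤
      k * (t * N / Fintype.card G) + y := by
  simp only [subProdQueries, Strategy.clean_append, not_and_or]
  refine (prob_or_le _ _).trans (add_le_add ?_ ?_)
  · rw [prob_fst (β := Fin k → Bool) fun x => ¬ S.Clean f h (List.ofFn x)]
    have := prob_not_clean_flatten_le S f (fun x : G => [x]) (l := 1) (N := N) (fun _ => rfl)
      (fun h hh => le_of_eq_of_le (prob_congr fun x => by simp [Strategy.Clean])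
        (hS.prob_point_le (h := h) (N := N) (by omega))) k h (by omega)
    refine le_of_eq_of_le (prob_congr fun x => ?_) this
    have : (List.ofFn fun j => [x j]).flatten = List.ofFn x := by
      rw [← Function.comp_def (fun a : G => [a]) x, ← List.map_ofFn, ← List.flatMap_def,
        List.flatMap_singleton']
    rw [this]
  · simpa [Strategy.Clean] using hS.prob_subProd_le (by omega : h.length + k ≤ N) hy hty

end Clean

/-! ### The tester and its guarantees. -/

section Tester

variable {G H : Type*} [Group G] [Group H]

/-- One round: a random subproduct test of size `k` and one of size `2 k`. -/
abbrev Round (G : Type*) (k : ℕ) :=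
  ((Fin k → G) × (Fin k → Bool)) × ((Fin (k + k) → G) × (Fin (k + k) → Bool))

/-- The queries of one round. -/
def roundQueries {k : ℕ} (p : Round G k) : List G := subProdQueries p.1 ++ subProdQueries p.2

/-- The queries of `r` rounds. -/
def queries {k r : ℕ} (ω : Fin r → Round G k) : List G :=
  (List.ofFn fun j => roundQueries (ω j)).flatten

theorem length_roundQueries {k : ℕ} (p : Round G k) : (roundQueries p).length = 3 * k + 2 := by
  simp [roundQueries, subProdQueries]
  omega

theorem length_queries {k r : ℕ} (ω : Fin r → Round G k) :
    (queries ω).length = r * (3 * k + 2) := by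
  simp [queries, List.length_flatten, List.map_ofFn, Function.comp_def, length_roundQueries]

theorem IsBudgeted.prob_not_clean_queries_le {G H : Type*} [Group G] [Fintype G] {t : ℕ} {f : G → H} {S : Strategy G (Option H)}
    (hS : IsBudgeted t f S) {k r N : ℕ} (hN : N = r * (3 * k + 2)) {y : ℝ} (hy : 0 ≤ y)
    (hty : t * N * (1 / 2 ^ k + 1 / Fintype.card G) ≤ y ^ 2) :
    prob (fun ω : Fin r → Round G k => ¬ S.Clean f [] (queries ω)) ≤
      r * (3 * k * (t * N / Fintype.card G) + 2 * y) := by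
  refine prob_not_clean_flatten_le S f roundQueries length_roundQueries (N := N)
    (fun h hh => ?_) r [] (by simp [hN])
  simp only [roundQueries, Strategy.clean_append, not_and_or]
  refine (prob_or_le _ _).trans ?_
  have h1 := hS.prob_not_clean_subProdQueries_le (k := k) (h := h) (by omega) hy hty
  have hty' : t * N * (1 / 2 ^ (k + k) + 1 / Fintype.card G) ≤ y ^ 2 := by
    refine le_trans ?_ hty
    gcongr
    · norm_num
    · omega
  rw [prob_fst (β := (Fin (k + k) → G) × (Fin (k + k) → Bool))
    fun p => ¬ S.Clean f h (subProdQueries p)]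
  have h2 := prob_prod_le (α := (Fin k → G) × (Fin k → Bool))
    (P := fun p => ¬ S.Clean f ((subProdQueries p.1).reverse ++ h) (subProdQueries p.2))
    fun p => hS.prob_not_clean_subProdQueries_le (k := k + k)
      (h := (subProdQueries p).reverse ++ h) (N := N)
      (by simp [subProdQueries]; omega) hy hty'
  refine (add_le_add h1 h2).trans_eq ?_
  push_cast
  ring

open Classical in
/-- Accept if the answers that are not erased agree with a homomorphism. -/
noncomputable def decideHom (L : List G) (as : List (Option H)) : Bool :=
  decide (∃ g : G → H, IsHom g ∧ List.Forall₂ (fun x a => a = none ∨ a = some (g x)) L as)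

theorem decideHom_eq_true_iff (L : List G) (as : List (Option H)) : decideHom L as = true ↔
    ∃ g : G → H, IsHom g ∧ List.Forall₂ (fun x a => a = none ∨ a = some (g x)) L as := by
  classical
  exact decide_eq_true_iff

/-- The tester that runs `r` rounds. -/
noncomputable def roundTester (G H : Type*) [Group G] [Group H] [Fintype G] (k r : ℕ) :
    Tester G H :=
  (PMF.uniformOfFintype (Fin r → Round G k)).map fun ω =>
    QueryTree.ofList (queries ω) (decideHom (queries ω))

theorem decideHom_of_clean_of_isHom {S : Strategy G (Option H)} {f : G → H} (hf : IsHom f)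
    {L : List G} (hc : S.Clean f [] L) : decideHom L (S.answers [] L) = true := by
  rw [hc.answers_eq, decideHom_eq_true_iff]
  refine ⟨f, hf, ?_⟩
  simp [List.forall₂_map_right_iff, List.forall₂_same]

theorem decideHom_of_erasure {t : ℕ} {S : Strategy G (Option H)} {f : G → H} (hf : IsHom f)
    (hS : IsErasureAdversary t f S) (L : List G) : decideHom L (S.answers [] L) = true := by
  rw [decideHom_eq_true_iff]
  refine ⟨f, hf, ?_⟩
  generalize ([] : List G) = h
  induction L generalizing h with
  | nil => exact .nil
  | cons x L ih => exact .cons (hS.eq_none_or h x) (ih _)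

theorem decideHom_of_clean {S : Strategy G (Option H)} {f : G → H}
    {L : List G} (hc : S.Clean f [] L) (h : decideHom L (S.answers [] L) = true) :
    ∃ g : G → H, IsHom g ∧ ∀ x ∈ L, f x = g x := by
  rw [hc.answers_eq, decideHom_eq_true_iff] at h
  obtain ⟨g, hg, h⟩ := h
  refine ⟨g, hg, ?_⟩
  simpa [List.forall₂_map_right_iff, List.forall₂_same] using h

variable [Fintype G]

theorem roundTester_outcome (k r : ℕ) (S : Strategy G (Option H)) (b : Bool) :
    (roundTester G H k r).outcome S b = ENNReal.ofReal
      (prob fun ω : Fin r → Round G k => decideHom (queries ω) (S.answers [] (queries ω)) = b) := by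
  classical
  rw [Tester.outcome, roundTester, PMF.map_comp, PMF.map_apply, tsum_fintype]
  simp only [Function.comp_apply, QueryTree.run_ofList, PMF.uniformOfFintype_apply]
  have h := prob_mem {ω : Fin r → Round G k |
    decideHom (queries ω) (S.answers [] (queries ω)) = b}
  simp only [Set.mem_ofPred_eq] at h
  rw [h, ENNReal.ofReal_div_of_pos (by positivity), ENNReal.ofReal_natCast, ENNReal.ofReal_natCast,
    ENNReal.div_eq_inv_mul, mul_comm, ← Finset.sum_filter, Finset.sum_const, nsmul_eq_mul,
    Set.ncard_eq_toFinset_card']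
  congr 3
  ext ω
  simp [eq_comm]

/-- A homomorphism that fits all queries of a round forces both of its tests to pass. In each round
one fixed size fails with probability at least 1/120, independently of other rounds. -/
theorem prob_consistent_le {f : G → H} {ε : ℝ} (hε : 0 < ε) (hf : ε < distToHom f) {k : ℕ}
    (hk : 8 ≤ k) (hkε : 9 ≤ k * ε) (r : ℕ) :
    prob (fun ω : Fin r → Round G k => ∃ g : G → H, IsHom g ∧ ∀ x ∈ queries ω, f x = g x) ≤
      (119 / 120) ^ r := by
  let Q (k : ℕ) (p : (Fin k → G) × (Fin k → Bool)) : Prop :=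
    f (subProd p.1 p.2) ≠ subProd (fun i => f (p.1 i)) p.2
  have hQ {k : ℕ} (p : (Fin k → G) × (Fin k → Bool)) {g : G → H} (hg : IsHom g)
      (h : ∀ x ∈ subProdQueries p, f x = g x) : ¬ Q k p := by
    simp only [subProdQueries, List.mem_append, List.mem_ofFn, List.mem_singleton] at h
    rw [not_not, h _ (.inr rfl), hg.map_subProd]
    congr 1
    ext i
    exact (h _ (.inl ⟨i, rfl⟩)).symm
  have h1 : prob (fun p : Round G k => ¬ Q k p.1 ∧ ¬ Q (k + k) p.2) ≤ 119 / 120 := by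
    have h2 := prob_add_prob_not (Q k)
    have h3 := prob_add_prob_not (Q (k + k))
    rcases subProdFail_of_far hε hf hk hkε with h | h
    · change _ ≤ prob (Q k) at h
      refine (prob_mono fun p hp => hp.1).trans ?_
      rw [prob_fst (β := (Fin (k + k) → G) × (Fin (k + k) → Bool)) fun p => ¬ Q k p]
      linarith
    · change _ ≤ prob (Q (k + k)) at h
      refine (prob_mono fun p hp => hp.2).trans ?_
      rw [prob_snd (α := (Fin k → G) × (Fin k → Bool)) fun p => ¬ Q (k + k) p]
      linarith
  refine le_trans ?_ (pow_le_pow_left₀ (prob_nonneg _) h1 r)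
  rw [← prob_forall_fin]
  refine prob_mono ?_
  rintro ω ⟨g, hg, h⟩ j
  have hj : ∀ x ∈ roundQueries (ω j), f x = g x := fun x hx =>
    h x (List.mem_flatten.2 ⟨_, List.mem_ofFn.2 ⟨j, rfl⟩, hx⟩)
  exact ⟨hQ _ hg fun x hx => hj x (List.mem_append_left _ hx),
    hQ _ hg fun x hx => hj x (List.mem_append_right _ hx)⟩

theorem roundTester_hasOneSidedError (k r t : ℕ) :
    (roundTester G H k r).HasOneSidedError (IsErasureAdversary t) := by
  intro f S hS hf
  rw [roundTester_outcome]
  simp [decideHom_of_erasure hf hS, prob_true]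

theorem roundTester_makesAtMost (k r : ℕ) :
    (roundTester G H k r).MakesAtMost (r * (3 * k + 2)) := by
  intro τ hτ
  obtain ⟨ω, -, rfl⟩ := (PMF.mem_support_map_iff _ _ _).1 hτ
  rw [← length_queries ω]
  exact QueryTree.ofList_makesAtMost _ _

theorem roundTester_isOnlineTester {t k r : ℕ} {ε : ℝ} (hε : 0 < ε) (hk : 8 ≤ k) (hkε : 9 ≤ k * ε) (hr : r = 600)
    {Adv : (G → H) → Strategy G (Option H) → Prop}
    (hAdv : ∀ f S, Adv f S → IsBudgeted t f S)
    (htk : 10 ^ 13 * (t * k ^ 2 : ℝ) ≤ Fintype.card G) (htk' : 10 ^ 13 * (t * k : ℝ) ≤ 2 ^ k) :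
    (roundTester G H k r).IsOnlineTester ε Adv := by
  intro f S hS
  have hG : (0 : ℝ) < Fintype.card G := by positivity
  have hk1 : (8 : ℝ) ≤ k := by exact_mod_cast hk
  have hr' : (r : ℝ) = 600 := by exact_mod_cast hr
  have hN : (((r * (3 * k + 2) : ℕ) : ℝ)) ≤ 3000 * k := by
    push_cast
    rw [hr']
    linarith
  have htN : (t : ℝ) * ((r * (3 * k + 2) : ℕ) : ℝ) ≤ 3000 * (t * k) :=
    (mul_le_mul_of_nonneg_left hN t.cast_nonneg).trans_eq (by ring)
  have h0 : (k : ℝ) * (t * ((r * (3 * k + 2) : ℕ) : ℝ) / Fintype.card G) ≤ 3000 / 10 ^ 13 := by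
    rw [← mul_div_assoc, div_le_iff₀ hG]
    have := mul_le_mul_of_nonneg_left htN k.cast_nonneg
    nlinarith
  -- The value 1/14400 makes the subproduct queries contribute `600 * 2 / 14400 = 1 / 12`, half of
  -- the allowed 1/6.
  have h0' : t * ((r * (3 * k + 2) : ℕ) : ℝ) * (1 / 2 ^ k + 1 / Fintype.card G) ≤
      (1 / 14400 : ℝ) ^ 2 := by
    have h1 : t * ((r * (3 * k + 2) : ℕ) : ℝ) * (1 / 2 ^ k) ≤ 3000 / 10 ^ 13 := by
      rw [mul_one_div, div_le_iff₀ (by positivity)]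
      linarith
    have h2 : t * ((r * (3 * k + 2) : ℕ) : ℝ) * (1 / Fintype.card G) ≤ 3000 / 10 ^ 13 := by
      rw [mul_one_div]
      refine le_trans ?_ h0
      exact le_mul_of_one_le_left (by positivity) (by linarith)
    rw [mul_add]
    refine (add_le_add h1 h2).trans ?_
    norm_num
  have h1 := (hAdv f S hS).prob_not_clean_queries_le (k := k) (r := r) rfl
    (by norm_num : (0 : ℝ) ≤ 1 / 14400) h0'
  have h2 : prob (fun ω : Fin r → Round G k => ¬ S.Clean f [] (queries ω)) ≤ 1 / 6 := by
    refine h1.trans ?_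
    rw [mul_assoc (3 : ℝ)]
    have : r * (3 * (3000 / 10 ^ 13) + 2 * (1 / 14400)) ≤ (1 / 6 : ℝ) := by
      rw [hr']
      norm_num
    refine le_trans ?_ this
    gcongr
  have h23 : (2 / 3 : ENNReal) = ENNReal.ofReal (2 / 3) := by
    rw [ENNReal.ofReal_div_of_pos (by norm_num)]
    simp
  refine ⟨fun hf => ?_, fun hf => ?_⟩ <;> rw [roundTester_outcome, h23] <;>
    apply ENNReal.ofReal_le_ofReal
  · have h3 := prob_add_prob_not fun ω : Fin r → Round G k => S.Clean f [] (queries ω)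
    have h4 : prob (fun ω : Fin r → Round G k => S.Clean f [] (queries ω)) ≤
        prob fun ω : Fin r → Round G k =>
          decideHom (queries ω) (S.answers [] (queries ω)) = true :=
      prob_mono fun ω hω => decideHom_of_clean_of_isHom hf hω
    linarith
  · have h3 := prob_add_prob_not fun ω : Fin r → Round G k =>
      decideHom (queries ω) (S.answers [] (queries ω)) = false
    -- A far function is accepted only after an unclean run, or after a clean one consistent with a
    -- homomorphism; each has probability at most 1/6.
    have h4 : prob (fun ω : Fin r → Round G k =>
        ¬ decideHom (queries ω) (S.answers [] (queries ω)) = false) ≤ 1 / 6 + (119 / 120) ^ r := by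
      refine le_trans ?_ (add_le_add h2 (prob_consistent_le hε hf hk hkε r))
      refine (prob_mono fun ω hω => ?_).trans (prob_or_le _ _)
      by_cases hc : S.Clean f [] (queries ω)
      · exact .inr (decideHom_of_clean hc (by simpa using hω))
      · exact .inl hc
    have h5 : (119 / 120 : ℝ) ^ r ≤ 1 / 6 := by
      have h6 : (119 / 120 : ℝ) ^ 120 ≤ 2 / 5 := by norm_num
      rw [hr, show 600 = 120 * 5 by rfl, pow_mul]
      refine (pow_le_pow_left₀ (by positivity) h6 5).trans ?_
      norm_num
    linarith

end Tester

end HomTest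

/-! ### Choice of parameters and the main theorem. -/

/-- One `l` in the exponent pays for `t`, the other, with `v`, for the linear factor, and `2 ^ 60`
for the constants. -/
theorem HomTest.mul_le_of_pow {t v : ℕ} (l : ℕ) (ht : (t : ℝ) ≤ 2 ^ l) :
    10 ^ 13 * (t * (v + l + l + 60 : ℕ) : ℝ) ≤ 2 ^ (v + l + l + 60) := by
  have h1 : ((v + l + 1 : ℕ) : ℝ) ≤ 2 ^ (v + l) := by
    exact_mod_cast Nat.lt_two_pow_self
  have h2 : ((v + l + l + 60 : ℕ) : ℝ) ≤ 60 * (v + l + 1 : ℕ) := by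
    exact_mod_cast (by omega)
  calc 10 ^ 13 * (t * (v + l + l + 60 : ℕ) : ℝ)
      ≤ 10 ^ 13 * (2 ^ l * (60 * 2 ^ (v + l))) := by
        gcongr
        exact h2.trans (by gcongr)
    _ = 2 ^ (v + l + l) * (60 * 10 ^ 13) := by rw [pow_add _ (v + l) l]; ring
    _ ≤ 2 ^ (v + l + l) * 2 ^ 60 := by gcongr; norm_num
    _ = _ := (pow_add _ _ _).symm

theorem HomTest.clog_le_logb_add_one (t : ℕ) : (Nat.clog 2 t : ℝ) ≤ Real.logb 2 t + 1 := by
  rw [← Real.natCeil_logb_natCast 2 t]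
  refine (Nat.ceil_lt_add_one ?_).le
  rcases t.eq_zero_or_pos with h | h
  · simp [h]
  · exact Real.logb_nonneg (by norm_num) (by exact_mod_cast h)

/-- The minimum becomes two inequalities. Clearing the denominator `Real.logb 2 |G| ^ 2` makes the
second automatic for `|G| = 1`, and `Real.logb 2 0 = 0` matches the convention for `t = 0`. -/
theorem theorem1p1 :
    ∃ c : ℝ, 0 < c ∧ ∃ C : ℝ, 0 < C ∧
      ∀ (G : Type*) (H : Type*) [Group G] [Finite G] [Group H] [Finite H]
        (ε : ℝ), 0 < ε → ε < 1 →
        ∀ t : ℕ,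
          (t : ℝ) ≤ c * ε ^ 2 * (Nat.card G : ℝ) →
          (t : ℝ) * Real.logb 2 (Nat.card G : ℝ) ^ 2 ≤ c * (Nat.card G : ℝ) →
          ∃ T : HomTest.Tester G H,
            (∃ q : ℕ, (q : ℝ) ≤ C * (1 / ε + Real.logb 2 (t : ℝ)) ∧ T.MakesAtMost q) ∧
            T.IsOnlineTester ε (HomTest.IsErasureAdversary t) ∧
            T.IsOnlineTester ε (HomTest.IsCorruptionAdversary t) ∧
            T.HasOneSidedError (HomTest.IsErasureAdversary t) := by
  refine ⟨1 / 10 ^ 18, by norm_num, 240000, by norm_num, ?_⟩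
  intro G H _ _ _ _ ε hε hε1 t ht1 ht2
  have := Fintype.ofFinite G
  rw [Nat.card_eq_fintype_card] at ht1 ht2
  have hG : (0 : ℝ) < Fintype.card G := by positivity
  set u := ⌈1 / ε⌉₊ with hu
  set l := Nat.clog 2 t with hl
  -- `9 * u` gives `9 ≤ k * ε` for soundness; `l + l + 60` makes `2 ^ k` dominate `t * k`.
  set k := 9 * u + l + l + 60 with hk
  have hu1 : 1 / ε ≤ u := Nat.le_ceil _
  have hu2 : (u : ℝ) < 1 / ε + 1 := Nat.ceil_lt_add_one (by positivity)
  have hl1 : (t : ℝ) ≤ 2 ^ l := by exact_mod_cast Nat.le_pow_clog (by norm_num) t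
  have hl2 := HomTest.clog_le_logb_add_one t
  have hε2 : 1 ≤ 1 / ε := (one_le_div hε).2 hε1.le
  have hlog : 0 ≤ Real.logb 2 t := by
    rcases t.eq_zero_or_pos with h | h
    · simp [h]
    · exact Real.logb_nonneg (by norm_num) (by exact_mod_cast h)
  have hkr : (k : ℝ) = 9 * u + l + l + 60 := by rw [hk]; push_cast; ring
  have hk8 : 8 ≤ k := by omega
  have hkε : 9 ≤ k * ε := by
    have : 9 * (1 / ε) * ε ≤ k * ε := by
      gcongr
      rw [hkr]
      have := l.cast_nonneg (α := ℝ)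
      linarith
    rwa [mul_assoc, one_div_mul_cancel hε.ne', mul_one] at this
  -- Rounding gives `k ≤ 9 / ε + 2 * logb 2 t + 71`, and `1 ≤ 1 / ε` absorbs the 71. Then `600 * (3
  -- * k + 2) ≤ 3000 * k` accounts for 240000.
  have hkle : (k : ℝ) ≤ 80 * (1 / ε + Real.logb 2 t) := by
    rw [hkr]
    linarith
  have htG : (t : ℝ) * Real.logb 2 t ^ 2 ≤ 1 / 10 ^ 18 * Fintype.card G := by
    rcases t.eq_zero_or_pos with h | h
    · simp [h]
    refine le_trans ?_ ht2
    gcongr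
    · norm_num
    · have : ε ^ 2 ≤ 1 := pow_le_one₀ hε.le hε1.le
      have : (t : ℝ) ≤ Fintype.card G := by nlinarith
      exact_mod_cast this
  have hte : (t : ℝ) * (1 / ε) ^ 2 ≤ 1 / 10 ^ 18 * Fintype.card G := by
    rw [div_pow, one_pow, mul_one_div, div_le_iff₀ (by positivity)]
    linarith
  have htk : 10 ^ 13 * (t * k ^ 2 : ℝ) ≤ Fintype.card G := by
    have h1 : (k : ℝ) ^ 2 ≤ 12800 * ((1 / ε) ^ 2 + Real.logb 2 t ^ 2) := by
      refine (pow_le_pow_left₀ k.cast_nonneg hkle 2).trans ?_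
      nlinarith [sq_nonneg (1 / ε - Real.logb 2 t)]
    have h2 := mul_le_mul_of_nonneg_left h1 (t.cast_nonneg (α := ℝ))
    linarith
  have htk' := HomTest.mul_le_of_pow (v := 9 * u) l hl1
  refine ⟨HomTest.roundTester G H k 600, ⟨600 * (3 * k + 2), ?_,
    HomTest.roundTester_makesAtMost k 600⟩,
    HomTest.roundTester_isOnlineTester hε hk8 hkε rfl (fun f S h => h.isBudgeted) htk htk',
    HomTest.roundTester_isOnlineTester hε hk8 hkε rfl (fun f S h => h.isBudgeted) htk htk',
    HomTest.roundTester_hasOneSidedError k 600 t⟩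
  have : (8 : ℝ) ≤ k := by exact_mod_cast hk8
  push_cast
  linarith
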